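/- For a semigroup $T$, let $l(T)$ denote the largest number of non-empty subsemigroups of $T$ in a chain (with respect to inclusion), minus $1$. For a group $G$ and $n\in\mathbb{N}$, let $B(G,n)$ denote the Brandt semigroup: its underlying set is $(\{1,\dots,n\}\times G\times\{1,\dots,n\})\cup\{0\}$, with $(i,g,j)(k,h,l)=(i,gh,l)$ if $j=k$, and all other products equal to $0$. Let $S$ be a finite inverse semigroup, that is, a finite semigroup in which for every $x$ there is a unique $y$ with $xyx=x$ and $yxy=y$. Let $J_1,\dots,J_m$ be the distinct $\mathscr{J}$-classes of $S$ (classes of elements generating the same principal two-sided ideal $S^1xS^1$). Then for each $i$ the number of $\mathscr{L}$-classes contained in $J_i$ equals the number of $\mathscr{R}$-classes contained in $J_i$ (elements are $\mathscr{L}$-related, respectively $\mathscr{R}$-related, if they generate the same principal left ideal $S^1x$, respectively right ideal $xS^1$); denote this number by $n_i$. Each $J_i$ contains a maximal subgroup of $S$ (a subsemigroup that is a group and is maximal with this property), and for any choice of maximal subgroups $G_i$ of $S$ with $G_i\subseteq J_i$, $$l(S) = -1+\sum_{i=1}^{m} l(B(G_i,n_i)) = -1+\sum_{i=1}^{m}\left[n_i\,(l(G_i)+1)+\frac{n_i(n_i-1)}{2}\,|G_i|+(n_i-1)\right].$$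 -/

import Mathlib

/-- A semigroup is inverse if every element `x` has exactly one `y` with
`x y x = x` and `y x y = y`. -/
def IsInverseSemigroup (S : Type*) [Semigroup S] : Prop :=
  ∀ x : S, ∃! y : S, x * y * x = x ∧ y * x * y = y

/-- The length `l(S)` of a finite semigroup: the largest number of non-empty subsemigroups in
a chain, minus one. It is an integer, and equals `-1` for the empty semigroup.
(Only meaningful when the chains have bounded size, for instance for finite `S`.) -/
noncomputable def semigroupLength (S : Type*) [Semigroup S] : ℤ :=
  ((Set.chainHeight {T : Subsemigroup S | (T : Set S).Nonempty} (· < ·)).toNat : ℤ) - 1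

/-- The principal left ideal `S¹x`. -/
def principalLeftIdeal {S : Type*} [Semigroup S] (x : S) : Set S :=
  {z | ∃ a : WithOne S, (z : WithOne S) = a * x}

/-- The principal right ideal `xS¹`. -/
def principalRightIdeal {S : Type*} [Semigroup S] (x : S) : Set S :=
  {z | ∃ b : WithOne S, (z : WithOne S) = x * b}

/-- The principal two-sided ideal `S¹xS¹`. -/
def principalIdeal {S : Type*} [Semigroup S] (x : S) : Set S :=
  {z | ∃ a b : WithOne S, (z : WithOne S) = a * x * b}

/-- Green's relation `L`: equality of principal left ideals. -/
def greenL (S : Type*) [Semigroup S] : Setoid S := Setoid.ker principalLeftIdeal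

/-- Green's relation `R`: equality of principal right ideals. -/
def greenR (S : Type*) [Semigroup S] : Setoid S := Setoid.ker principalRightIdeal

/-- Green's relation `J`: equality of principal two-sided ideals. -/
def greenJ (S : Type*) [Semigroup S] : Setoid S := Setoid.ker principalIdeal

/-- The number of `L`-classes contained in `J`. -/
noncomputable def numLClasses {S : Type*} [Semigroup S] (J : Set S) : ℕ :=
  {C : Set S | C ∈ (greenL S).classes ∧ C ⊆ J}.ncard

/-- The number of `R`-classes contained in `J`. -/
noncomputable def numRClasses {S : Type*} [Semigroup S] (J : Set S) : ℕ :=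
  {C : Set S | C ∈ (greenR S).classes ∧ C ⊆ J}.ncard

/-- A subsemigroup which is a group under the multiplication of the semigroup
(its identity need not be an identity of the whole semigroup). -/
def Subsemigroup.IsGroup {S : Type*} [Semigroup S] (H : Subsemigroup S) : Prop :=
  ∃ e ∈ H, (∀ a ∈ H, e * a = a ∧ a * e = a) ∧ ∀ a ∈ H, ∃ b ∈ H, a * b = e ∧ b * a = e

/-- A maximal subgroup of a semigroup: maximal under inclusion among the subsemigroups that
are groups. -/
def Subsemigroup.IsMaximalSubgroup {S : Type*} [Semigroup S] (H : Subsemigroup S) : Prop :=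
  Maximal Subsemigroup.IsGroup H

/-- The underlying set `({1, …, n} × G × {1, …, n}) ∪ {0}` of the Brandt semigroup `B(G, n)`. -/
inductive BrandtSemigroup (G : Type*) (n : ℕ) where
  | zero : BrandtSemigroup G n
  | elt : Fin n → G → Fin n → BrandtSemigroup G n

namespace BrandtSemigroup

variable {G : Type*} {n : ℕ}

/-- `(i, g, j) (k, h, l) = (i, g h, l)` if `j = k`, and all other products are `0`. -/
def mul [Mul G] : BrandtSemigroup G n → BrandtSemigroup G n → BrandtSemigroup G n
  | elt i g j, elt k h l => if j = k then elt i (g * h) l else zero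
  | _, _ => zero

/-- The multiplication only uses that of `G`, so it is defined for any semigroup `G`; it is
the usual Brandt semigroup when `G` is a group. -/
instance [Semigroup G] : Semigroup (BrandtSemigroup G n) where
  mul := mul
  mul_assoc a b c := by
    change mul (mul a b) c = mul a (mul b c)
    rcases a with _ | ⟨i, g, j⟩ <;> rcases b with _ | ⟨k, h, l⟩ <;>
      rcases c with _ | ⟨p, q, r⟩ <;> simp only [mul] <;> split_ifs <;>
      simp_all [mul, mul_assoc]

end BrandtSemigroup

/-! For a subset `J` of `S`, consider the subsets of `J` closed under those products that stay in
`J`, and let `relLength J` be the length of a longest chain of them starting at the empty set. Then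
`l(S) + 1` is `relLength` of all of `S`.

If `π` maps to a finite poset and `π (x * y)` lies below both `π x` and `π y`, then `relLength` is
the sum over the fibres (`relLength_eq_sum_fibers`). With `π x = S¹xS¹` the fibres are the
`J`-classes. In a finite inverse semigroup, each of them is, as a set with partial product, the
non-zero part of some `B(G, n)` (`relLength_jClass`), whose own length is `l(B(G, n))`, because the
zero contributes exactly 1.

It remains to find `relLength (nonzero G n)`. From below: upper triangular elements split into `n`
diagonal copies of `G` and `n.choose 2` strictly upper positions, where no product stays, so that
each yields `|G|` steps; after that, `n - 1` further steps merge the indices into one full block.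
From above: `potential` adds the heights of the diagonal entries, a weight of at most `|G|` for each
pair of indices, and the number of mergers of strongly connected components. It strictly increases
along chains (`potential_strictMono`), since once two indices are connected both ways, the
off-diagonal entry is determined by the diagonal one. -/

/-! ### Heights in finite posets. -/

section NatHeight

variable {P Q : Type*} [PartialOrder P] [PartialOrder Q]

/-- The height of an element of a finite poset, as a natural number. -/
noncomputable def natHeight (x : P) : ℕ := (Order.height x).toNat

theorem coe_natHeight [Finite P] (x : P) : (natHeight x : ℕ∞) = Order.height x := by
  cases nonempty_fintype P
  refine ENat.natCast_toNat (ne_top_of_le_ne_top (ENat.natCast_ne_top (Fintype.card P)) ?_)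
  refine Order.height_le fun p _ => ?_
  exact_mod_cast p.length_lt_card.le

theorem natHeight_strictMono [Finite P] : StrictMono (natHeight : P → ℕ) := by
  intro x y h
  have := Order.height_strictMono h (by rw [← coe_natHeight]; exact ENat.natCast_lt_top _)
  rw [← coe_natHeight, ← coe_natHeight] at this
  exact_mod_cast this

theorem natHeight_le_of_strictMono [Finite P] (f : P → ℕ) (hf : StrictMono f) (x : P) :
    natHeight x ≤ f x := by
  induction x using WellFoundedLT.induction with
  | _ x ih =>
    have : Order.height x ≤ (f x : ℕ) := by
      rw [Order.height_le_coe_iff]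
      intro y hy
      rw [← coe_natHeight]
      exact_mod_cast (ih y hy).trans_lt (hf hy)
    rw [← coe_natHeight] at this
    exact_mod_cast this

theorem natHeight_orderIso (e : P ≃o Q) (x : P) : natHeight (e x) = natHeight x := by
  rw [natHeight, natHeight, Order.height_orderIso]

/-- A chain up to `a` can be continued by the image of a chain up to `p`. All lower bounds on
lengths come from this concatenation. -/
theorem natHeight_add_le [Finite P] [Finite Q] (f : P → Q) (hf : StrictMono f) (a : Q)
    (ha : ∀ p, a ≤ f p) (p : P) : natHeight a + natHeight p ≤ natHeight (f p) := by
  generalize hn : natHeight p = n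
  induction n generalizing p with
  | zero => exact natHeight_strictMono.monotone (ha p)
  | succ n ih =>
    have h := coe_natHeight p
    rw [hn] at h
    obtain ⟨-, ⟨q, hq, hqn⟩, -⟩ := Order.height_eq_coe_add_one_iff.1 (by exact_mod_cast h.symm)
    rw [← coe_natHeight] at hqn
    have h1 := ih q (by exact_mod_cast hqn)
    have h2 := natHeight_strictMono (hf hq)
    omega

theorem natHeight_fin {n : ℕ} (i : Fin n) : natHeight i = i := by
  refine le_antisymm (natHeight_le_of_strictMono _ Fin.val_strictMono i) ?_
  obtain ⟨i, hi⟩ := i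
  induction i with
  | zero => simp
  | succ i ih =>
    have h1 := ih (by omega)
    have h2 : natHeight (⟨i, by omega⟩ : Fin n) < natHeight (⟨i + 1, hi⟩ : Fin n) :=
      natHeight_strictMono (by simp [Fin.lt_def])
    simp only at h1 ⊢
    omega

theorem chainHeight_ne_bot_eq_natHeight_top [Finite P] [BoundedOrder P] :
    Set.chainHeight {a : P | a ≠ ⊥} (· < ·) = natHeight (⊤ : P) := by
  apply le_antisymm
  · refine iSup_le ?_
    rintro ⟨t, ht, hc⟩
    have hinj : Set.InjOn (natHeight : P → ℕ) t := by
      intro x hx y hy hxy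
      by_contra hne
      rcases hc hx hy hne with h | h
      · exact (natHeight_strictMono h).ne hxy
      · exact (natHeight_strictMono h).ne' hxy
    have hsub : natHeight '' t ⊆ (Finset.Icc 1 (natHeight (⊤ : P)) : Set ℕ) := by
      rintro _ ⟨x, hx, rfl⟩
      have h1 := natHeight_strictMono (bot_lt_iff_ne_bot.2 (ht hx))
      have h2 := natHeight_strictMono.monotone (le_top (a := x))
      simp only [Finset.coe_Icc, Set.mem_Icc]
      omega
    calc t.encard = (natHeight '' t).encard := hinj.encard_image.symm
      _ ≤ _ := Set.encard_le_encard hsub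
      _ = natHeight (⊤ : P) := by rw [Set.encard_coe_eq_coe_finsetCard]; simp
  · obtain ⟨p, -, hp⟩ := Order.exists_series_of_le_height (⊤ : P) (coe_natHeight (⊤ : P)).le
    -- The first term of the series is dropped, since it may be `⊥`; the remaining `p.length` terms
    -- are not.
    have hs : ∀ i j : Fin p.length, i < j → p i.succ < p j.succ := fun i j hij =>
      p.strictMono (Fin.succ_lt_succ_iff.2 hij)
    have hmono : StrictMono fun i : Fin p.length => p i.succ := hs
    have hle := Set.encard_le_chainHeight_of_isChain (r := (· < ·)) {a : P | a ≠ ⊥}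
      (Set.range fun i : Fin p.length => p i.succ) ?_ ?_
    · rw [← Set.image_univ, hmono.injective.injOn.encard_image, Set.encard_univ] at hle
      simpa [hp] using hle
    · rintro _ ⟨i, rfl⟩
      exact (bot_le.trans_lt (p.strictMono (Fin.succ_pos i))).ne'
    · rintro _ ⟨i, rfl⟩ _ ⟨j, rfl⟩ hij
      rcases lt_trichotomy i j with h | h | h
      · exact Or.inl (hs i j h)
      · exact absurd (by rw [h]) hij
      · exact Or.inr (hs j i h)

end NatHeight

/-! ### Chains of relative subsemigroups and their splitting over fibres. -/

section RelSubsemigroup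

variable {S T : Type*} [Semigroup S] [Semigroup T]

/-- The subsets of `J` which are closed under those products that lie in `J`. -/
abbrev RelSubsemigroup (J : Set S) : Type _ :=
  {X : Set S // X ⊆ J ∧ ∀ x ∈ X, ∀ y ∈ X, x * y ∈ J → x * y ∈ X}

/-- The set `J` as a relative subsemigroup of itself. -/
def RelSubsemigroup.full (J : Set S) : RelSubsemigroup J :=
  ⟨J, subset_rfl, fun _ _ _ _ h => h⟩

/-- The trace of a relative subsemigroup on a smaller set. -/
def RelSubsemigroup.inter {J : Set S} (X : RelSubsemigroup J) (K : Set S) :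
    RelSubsemigroup (J ∩ K) :=
  ⟨X.1 ∩ K, Set.inter_subset_inter_left _ X.2.1,
    fun x hx y hy h => ⟨X.2.2 x hx.1 y hy.1 h.1, h.2⟩⟩

/-- The largest length of a chain of relative subsemigroups of `J`, the empty one included. -/
noncomputable def relLength (J : Set S) : ℕ := natHeight (RelSubsemigroup.full J)

theorem relLength_le_of_strictMono [Finite S] {J : Set S} (f : RelSubsemigroup J → ℕ)
    (hf : StrictMono f) : relLength J ≤ f (RelSubsemigroup.full J) :=
  natHeight_le_of_strictMono f hf _

theorem semigroupLength_eq_relLength_univ (S : Type*) [Semigroup S] [Finite S] :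
    semigroupLength S = (relLength (Set.univ : Set S) : ℤ) - 1 := by
  have : Finite (Subsemigroup S) := Finite.of_injective _ SetLike.coe_injective
  let e : Subsemigroup S ≃o RelSubsemigroup (Set.univ : Set S) :=
    { toFun := fun T => ⟨T, Set.subset_univ _, fun x hx y hy _ => T.mul_mem hx hy⟩
      invFun := fun X => ⟨X.1, fun {x y} hx hy => X.2.2 x hx y hy (Set.mem_univ _)⟩
      left_inv := fun T => rfl
      right_inv := fun X => rfl
      map_rel_iff' := Iff.rfl }
  have h : {T : Subsemigroup S | (T : Set S).Nonempty} = {T | T ≠ ⊥} := by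
    ext T
    simp only [Set.mem_ofPred_eq, Set.nonempty_iff_ne_empty, ← Subsemigroup.coe_bot, ne_eq,
      SetLike.coe_set_eq]
  rw [semigroupLength, h, chainHeight_ne_bot_eq_natHeight_top, ENat.toNat_natCast, relLength,
    ← natHeight_orderIso e]
  congr 2

theorem relLength_eq_of_equivOn [Finite S] [Finite T] {J : Set S} {K : Set T} (φ : S → T)
    (hφ : Set.BijOn φ J K) (hmem : ∀ x ∈ J, ∀ y ∈ J, φ x * φ y ∈ K ↔ x * y ∈ J)
    (hmul : ∀ x ∈ J, ∀ y ∈ J, x * y ∈ J → φ (x * y) = φ x * φ y) :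
    relLength J = relLength K := by
  let e : RelSubsemigroup J ≃o RelSubsemigroup K :=
    { toFun := fun X => ⟨φ '' X.1, by
        rintro _ ⟨x, hx, rfl⟩
        exact hφ.mapsTo (X.2.1 hx), by
        rintro _ ⟨x, hx, rfl⟩ _ ⟨y, hy, rfl⟩ h
        have hxy := (hmem x (X.2.1 hx) y (X.2.1 hy)).1 h
        exact ⟨x * y, X.2.2 x hx y hy hxy, hmul x (X.2.1 hx) y (X.2.1 hy) hxy⟩⟩
      invFun := fun Y => ⟨J ∩ φ ⁻¹' Y.1, Set.inter_subset_left, by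
        rintro x ⟨hx, hx'⟩ y ⟨hy, hy'⟩ h
        refine ⟨h, ?_⟩
        rw [Set.mem_preimage, hmul x hx y hy h]
        exact Y.2.2 _ hx' _ hy' ((hmem x hx y hy).2 h)⟩
      left_inv := fun X => Subtype.ext <| by
        ext x
        constructor
        · rintro ⟨hx, y, hy, hxy⟩
          rwa [← hφ.injOn (X.2.1 hy) hx hxy]
        · exact fun hx => ⟨X.2.1 hx, x, hx, rfl⟩
      right_inv := fun Y => Subtype.ext <| by
        ext y
        constructor
        · rintro ⟨x, ⟨-, hx⟩, rfl⟩
          exact hx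
        · intro hy
          obtain ⟨x, hx, rfl⟩ := hφ.surjOn (Y.2.1 hy)
          exact ⟨x, ⟨hx, hy⟩, rfl⟩
      map_rel_iff' := by
        intro X Y
        change φ '' X.1 ⊆ φ '' Y.1 ↔ X.1 ⊆ Y.1
        exact hφ.injOn.image_subset_image_iff X.2.1 Y.2.1 }
  rw [relLength, relLength, ← natHeight_orderIso e]
  congr 1
  exact Subtype.ext hφ.image_eq

/-- Every subset of `J` is vacuously closed here, so a chain may add one element at a time. -/
theorem relLength_of_mul_notMem [Finite S] {J : Set S}
    (hJ : ∀ x ∈ J, ∀ y ∈ J, x * y ∉ J) : relLength J = J.ncard := by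
  have key : ∀ (n : ℕ) (K : Set S) (hK : K ⊆ J), K.ncard = n →
      n ≤ natHeight (⟨K, hK, fun x hx y hy h => absurd h (hJ x (hK hx) y (hK hy))⟩ :
        RelSubsemigroup J) := by
    intro n
    induction n with
    | zero => simp
    | succ n ih =>
      intro K hK hn
      obtain ⟨a, ha⟩ : K.Nonempty := by
        rw [← Set.ncard_pos]; omega
      have hd := Set.ncard_sdiff_singleton_of_mem ha
      have h1 := ih (K \ {a}) (Set.sdiff_subset.trans hK) (by omega)
      refine h1.trans_lt (natHeight_strictMono ?_)
      change K \ {a} ⊂ K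
      exact Set.sdiff_singleton_ssubset.2 ha
  refine le_antisymm ?_ (key _ J subset_rfl rfl)
  exact relLength_le_of_strictMono (fun X => X.1.ncard)
    fun X Y h => Set.ncard_lt_ncard (show X.1 ⊂ Y.1 from h)

theorem relLength_empty [Finite S] : relLength (∅ : Set S) = 0 := by
  rw [relLength_of_mul_notMem (by simp), Set.ncard_empty]

theorem relLength_singleton [Finite S] (a : S) : relLength ({a} : Set S) = 1 := by
  apply le_antisymm
  · refine (relLength_le_of_strictMono (fun X => X.1.ncard)
      fun X Y h => Set.ncard_lt_ncard (show X.1 ⊂ Y.1 from h)).trans ?_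
    simp [RelSubsemigroup.full]
  · refine Nat.one_le_iff_ne_zero.2 (Nat.ne_zero_of_lt (natHeight_strictMono
      (a := (⟨∅, by simp, by simp⟩ : RelSubsemigroup {a})) ?_))
    exact (Set.singleton_nonempty a).empty_ssubset

theorem relLength_le_natHeight [Finite S] {J K : Set S} (hKJ : K ⊆ J)
    (hK : ∀ x ∈ K, ∀ y ∈ K, x * y ∈ J → x * y ∈ K) :
    relLength K ≤ natHeight (⟨K, hKJ, hK⟩ : RelSubsemigroup J) := by
  let f : RelSubsemigroup K → RelSubsemigroup J := fun X =>
    ⟨X.1, X.2.1.trans hKJ, fun x hx y hy h =>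
      X.2.2 x hx y hy (hK x (X.2.1 hx) y (X.2.1 hy) h)⟩
  have hf : StrictMono f := fun X Y h => h
  exact (Nat.le_add_left _ _).trans (natHeight_add_le f hf ⟨∅, by simp, by simp⟩
    (fun X => Set.empty_subset X.1) (RelSubsemigroup.full K))

/-- Fibres are added from the bottom up. For `i` maximal in `L`, the part over `L.erase i` absorbs
products with the fibre over `i`, and products within that fibre either stay there or drop into this
part; so a chain in the fibre can be stacked on top of it. -/
theorem sum_relLength_fibers_le [Finite S] {ι : Type*} [PartialOrder ι] [DecidableEq ι]
    {J : Set S} (π : S → ι)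
    (hπ : ∀ x ∈ J, ∀ y ∈ J, x * y ∈ J → π (x * y) ≤ π x ∧ π (x * y) ≤ π y) (L : Finset ι)
    (hL : ∀ i ∈ L, ∀ j ≤ i, (∃ x ∈ J, π x = j) → j ∈ L) :
    ∑ i ∈ L, relLength (J ∩ π ⁻¹' {i}) ≤
      natHeight (⟨{x ∈ J | π x ∈ L}, Set.sep_subset _ _, fun x hx y hy h =>
        ⟨h, hL _ hx.2 _ (hπ x hx.1 y hy.1 h).1 ⟨_, h, rfl⟩⟩⟩ : RelSubsemigroup J) := by
  induction hn : L.card generalizing L with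
  | zero => simp [Finset.card_eq_zero.1 hn]
  | succ n ih =>
    obtain ⟨i, hi⟩ := L.exists_maximal (Finset.card_pos.1 (by omega))
    have hL' : ∀ k ∈ L.erase i, ∀ j ≤ k, (∃ x ∈ J, π x = j) → j ∈ L.erase i := by
      intro k hk j hjk hj
      refine Finset.mem_erase.2 ⟨?_, hL k (Finset.mem_of_mem_erase hk) j hjk hj⟩
      rintro rfl
      exact (Finset.mem_erase.1 hk).1
        (le_antisymm (hi.2 (Finset.mem_of_mem_erase hk) hjk) hjk)
    have h1 := ih (L.erase i) hL' (by rw [Finset.card_erase_of_mem hi.1, hn]; rfl)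
    rw [← Finset.sum_erase_add _ _ hi.1]
    let f : RelSubsemigroup (J ∩ π ⁻¹' {i}) → RelSubsemigroup J := fun X =>
      ⟨{x ∈ J | π x ∈ L.erase i} ∪ X.1,
        Set.union_subset (Set.sep_subset _ _) (X.2.1.trans Set.inter_subset_left), by
        rintro x hx y hy h
        have hxJ : x ∈ J := hx.elim (fun h => h.1) (fun h => (X.2.1 h).1)
        have hyJ : y ∈ J := hy.elim (fun h => h.1) (fun h => (X.2.1 h).1)
        obtain ⟨h2, h3⟩ := hπ x hxJ y hyJ h
        rcases hx with hx | hx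
        · exact Or.inl ⟨h, hL' _ hx.2 _ h2 ⟨_, h, rfl⟩⟩
        rcases hy with hy | hy
        · exact Or.inl ⟨h, hL' _ hy.2 _ h3 ⟨_, h, rfl⟩⟩
        by_cases h4 : π (x * y) = i
        · exact Or.inr (X.2.2 x hx y hy ⟨h, h4⟩)
        · refine Or.inl ⟨h, Finset.mem_erase.2 ⟨h4, hL i hi.1 _ ?_ ⟨_, h, rfl⟩⟩⟩
          have : π x = i := (X.2.1 hx).2
          exact this ▸ h2⟩
    have hf : StrictMono f := by
      apply Monotone.strictMono_of_injective
      · intro X Y h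
        exact Set.union_subset_union_right _ h
      · intro X Y h
        have h2 := congrArg (fun Z : RelSubsemigroup J => Z.1 ∩ π ⁻¹' {i}) h
        have key : ∀ X : RelSubsemigroup (J ∩ π ⁻¹' {i}), (f X).1 ∩ π ⁻¹' {i} = X.1 := by
          intro X
          ext x
          constructor
          · rintro ⟨hx | hx, hxi⟩
            · exact absurd hxi (Finset.mem_erase.1 hx.2).1
            · exact hx
          · exact fun hx => ⟨Or.inr hx, (X.2.1 hx).2⟩
        exact Subtype.ext ((key X).symm.trans (h2.trans (key Y)))
    have h2 := natHeight_add_le f hf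
      ⟨{x ∈ J | π x ∈ L.erase i}, Set.sep_subset _ _, fun x hx y hy h =>
        ⟨h, hL' _ hx.2 _ (hπ x hx.1 y hy.1 h).1 ⟨_, h, rfl⟩⟩⟩
      (fun X => Set.subset_union_left (s := {x ∈ J | π x ∈ L.erase i}) (t := X.1))
      (RelSubsemigroup.full _)
    refine (Nat.add_le_add_right h1 _).trans (h2.trans (le_of_eq ?_))
    congr 1
    apply Subtype.ext
    ext x
    constructor
    · rintro (hx | hx)
      · exact ⟨hx.1, Finset.mem_of_mem_erase hx.2⟩
      · exact ⟨hx.1, (show π x = i from hx.2) ▸ hi.1⟩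
    · rintro ⟨hx, hxL⟩
      by_cases h : π x = i
      · exact Or.inr ⟨hx, h⟩
      · exact Or.inl ⟨hx, Finset.mem_erase.2 ⟨h, hxL⟩⟩

/-- For the upper bound, enlarging a relative subsemigroup enlarges its trace on the fibre of any
new element, so the sum of the heights of the traces is strictly monotone. -/
theorem relLength_eq_sum_fibers [Finite S] {ι : Type*} [PartialOrder ι] [Fintype ι]
    {J : Set S} (π : S → ι)
    (hπ : ∀ x ∈ J, ∀ y ∈ J, x * y ∈ J → π (x * y) ≤ π x ∧ π (x * y) ≤ π y) :
    relLength J = ∑ i, relLength (J ∩ π ⁻¹' {i}) := by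
  classical
  apply le_antisymm
  · refine relLength_le_of_strictMono (fun X => ∑ i, natHeight (X.inter (π ⁻¹' {i}))) ?_
    intro X Y h
    have hle : ∀ i, X.inter (π ⁻¹' {i}) ≤ Y.inter (π ⁻¹' {i}) := fun i =>
      Set.inter_subset_inter_left _ h.le
    obtain ⟨x, hxY, hxX⟩ := Set.exists_of_ssubset (show X.1 ⊂ Y.1 from h)
    refine Finset.sum_lt_sum (fun i _ => natHeight_strictMono.monotone (hle i))
      ⟨π x, Finset.mem_univ _, natHeight_strictMono (lt_of_le_of_ne (hle _) fun heq => hxX ?_)⟩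
    have : x ∈ (X.inter (π ⁻¹' {π x})).1 := heq ▸ ⟨hxY, rfl⟩
    exact this.1
  · refine (sum_relLength_fibers_le π hπ Finset.univ (by simp)).trans (le_of_eq ?_)
    rw [relLength]
    congr 1
    apply Subtype.ext
    simp [RelSubsemigroup.full]

end RelSubsemigroup

theorem Fin.sum_card_Ioi (n : ℕ) : ∑ i : Fin n, (Finset.Ioi i).card = n.choose 2 := by
  simp only [Fin.card_Ioi]
  rw [Fin.sum_univ_eq_sum_range (fun i => n - 1 - i) n, Finset.sum_range_reflect (fun i => i) n,
    Finset.sum_range_id, Nat.choose_two_right]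

/-! ### The length of a Brandt semigroup. -/

namespace BrandtSemigroup

variable {G : Type*} {n : ℕ}

instance [Finite G] : Finite (BrandtSemigroup G n) :=
  Finite.of_surjective (fun o : Option (Fin n × G × Fin n) =>
    o.elim zero fun p => elt p.1 p.2.1 p.2.2) (by
      rintro (_ | ⟨i, g, j⟩)
      · exact ⟨none, rfl⟩
      · exact ⟨some (i, g, j), rfl⟩)

variable (G n) in
/-- The set of non-zero elements of a Brandt semigroup. -/
def nonzero : Set (BrandtSemigroup G n) := {x | x ≠ zero}

theorem elt_mem_nonzero (i j : Fin n) (g : G) : elt i g j ∈ nonzero G n := by simp [nonzero]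

/-- The elements of `G` in position `(i, j)` of a subset of a Brandt semigroup. -/
def entry (X : Set (BrandtSemigroup G n)) (i j : Fin n) : Set G := {g | elt i g j ∈ X}

theorem entry_mono {X Y : Set (BrandtSemigroup G n)} (h : X ⊆ Y) (i j : Fin n) :
    entry X i j ⊆ entry Y i j := fun _ hg => h hg

open Classical in
/-- The contribution of a pair of indices to the length of a chain of subsemigroups. -/
noncomputable def pairWeight (X : Set (BrandtSemigroup G n)) (i j : Fin n) : ℕ :=
  if (entry X i j).Nonempty ∧ (entry X j i).Nonempty then Nat.card G
  else (entry X i j).ncard + (entry X j i).ncard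

theorem ncard_entry_le [Finite G] (X : Set (BrandtSemigroup G n)) (i j : Fin n) :
    (entry X i j).ncard ≤ Nat.card G := by
  rw [← Set.ncard_univ]
  exact Set.ncard_le_ncard (Set.subset_univ _)

/-- Unless both entries are inhabited, one of them is empty and the weight counts a single subset of
`G`. Hence passing to the value `|G|` never lowers the weight. -/
theorem pairWeight_le [Finite G] (X : Set (BrandtSemigroup G n)) (i j : Fin n) :
    pairWeight X i j ≤ Nat.card G := by
  rw [pairWeight]
  split_ifs with h
  · exact le_rfl
  · rw [not_and_or, Set.not_nonempty_iff_eq_empty, Set.not_nonempty_iff_eq_empty] at h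
    rcases h with h | h
    · simpa [h] using ncard_entry_le X j i
    · simpa [h] using ncard_entry_le X i j

theorem pairWeight_mono [Finite G] {X Y : Set (BrandtSemigroup G n)} (h : X ⊆ Y)
    (i j : Fin n) : pairWeight X i j ≤ pairWeight Y i j := by
  by_cases hY : (entry Y i j).Nonempty ∧ (entry Y j i).Nonempty
  · rw [pairWeight.eq_def Y, if_pos hY]
    exact pairWeight_le X i j
  · have hX : ¬ ((entry X i j).Nonempty ∧ (entry X j i).Nonempty) := fun hX =>
      hY ⟨hX.1.mono (entry_mono h i j), hX.2.mono (entry_mono h j i)⟩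
    rw [pairWeight, if_neg hX, pairWeight, if_neg hY]
    exact Nat.add_le_add (Set.ncard_le_ncard (entry_mono h i j))
      (Set.ncard_le_ncard (entry_mono h j i))

theorem entry_eq_of_pairWeight_eq [Finite G] {X Y : Set (BrandtSemigroup G n)} (h : X ⊆ Y)
    {i j : Fin n} (hY : ¬ ((entry Y i j).Nonempty ∧ (entry Y j i).Nonempty))
    (heq : pairWeight X i j = pairWeight Y i j) :
    entry X i j = entry Y i j ∧ entry X j i = entry Y j i := by
  have hX : ¬ ((entry X i j).Nonempty ∧ (entry X j i).Nonempty) := fun hX =>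
    hY ⟨hX.1.mono (entry_mono h i j), hX.2.mono (entry_mono h j i)⟩
  rw [pairWeight, if_neg hX, pairWeight, if_neg hY] at heq
  have h1 := Set.ncard_le_ncard (entry_mono h i j)
  have h2 := Set.ncard_le_ncard (entry_mono h j i)
  exact ⟨Set.eq_of_subset_of_ncard_le (entry_mono h i j) (by omega),
    Set.eq_of_subset_of_ncard_le (entry_mono h j i) (by omega)⟩

section Semigroup

variable [Semigroup G]

theorem elt_mul_elt (i j k l : Fin n) (g h : G) :
    elt i g j * elt k h l = if j = k then elt i (g * h) l else zero := rfl

theorem zero_mul (x : BrandtSemigroup G n) : zero * x = zero := rfl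

theorem mul_zero (x : BrandtSemigroup G n) : x * zero = zero := by cases x <;> rfl

theorem elt_mul_elt_mem_nonzero (i j k l : Fin n) (g h : G) :
    elt i g j * elt k h l ∈ nonzero G n ↔ j = k := by
  rw [elt_mul_elt]
  split_ifs with h <;> simp [nonzero, h]

/-- The fibres of "non-zero" are `{zero}` and its complement; the 1 from `{zero}` cancels the `-1`
in the definition of length. -/
theorem semigroupLength_eq [Finite G] :
    semigroupLength (BrandtSemigroup G n) = relLength (nonzero G n) := by
  let π : BrandtSemigroup G n → Bool := fun x => x.casesOn false fun _ _ _ => true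
  have h := relLength_eq_sum_fibers (J := Set.univ) π (by
    rintro (_ | ⟨i, g, j⟩) - (_ | ⟨k, h, l⟩) - -
    · simp [zero_mul, π]
    · simp [zero_mul, π]
    · simp [mul_zero, π]
    · simp [π, Bool.le_true])
  have h0 : Set.univ ∩ π ⁻¹' {false} = {zero} := by
    ext (_ | ⟨i, g, j⟩) <;> simp [π]
  have h1 : Set.univ ∩ π ⁻¹' {true} = nonzero G n := by
    ext (_ | ⟨i, g, j⟩) <;> simp [π, nonzero]
  rw [Fintype.sum_bool, h0, h1, relLength_singleton] at h
  rw [semigroupLength_eq_relLength_univ, h]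
  push_cast
  ring

theorem mul_mem_entry (X : RelSubsemigroup (nonzero G n)) {i j k : Fin n} {g h : G}
    (hg : g ∈ entry X.1 i j) (hh : h ∈ entry X.1 j k) : g * h ∈ entry X.1 i k := by
  have := X.2.2 _ hg _ hh ((elt_mul_elt_mem_nonzero ..).2 rfl)
  rwa [elt_mul_elt, if_pos rfl] at this

/-- A diagonal entry as a relative subsemigroup of `G`. -/
def diagonal (X : RelSubsemigroup (nonzero G n)) (i : Fin n) :
    RelSubsemigroup (Set.univ : Set G) :=
  ⟨entry X.1 i i, Set.subset_univ _, fun _ hg _ hh _ => mul_mem_entry X hg hh⟩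

/-- The indices `i` and `j` are equivalent if both entries `(i, j)` and `(j, i)` are inhabited. -/
def strongSetoid (X : RelSubsemigroup (nonzero G n)) : Setoid (Fin n) where
  r i j := i = j ∨ (entry X.1 i j).Nonempty ∧ (entry X.1 j i).Nonempty
  iseqv :=
    { refl := fun i => Or.inl rfl
      symm := fun h => h.imp Eq.symm And.symm
      trans := by
        rintro i j k (rfl | ⟨⟨a, ha⟩, b, hb⟩) (rfl | ⟨⟨c, hc⟩, d, hd⟩)
        · exact Or.inl rfl
        · exact Or.inr ⟨⟨c, hc⟩, d, hd⟩
        · exact Or.inr ⟨⟨a, ha⟩, b, hb⟩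
        · exact Or.inr ⟨⟨_, mul_mem_entry X ha hc⟩, _, mul_mem_entry X hd hb⟩ }

theorem strongSetoid_mono {X Y : RelSubsemigroup (nonzero G n)} (h : X ≤ Y) {i j : Fin n}
    (hij : strongSetoid X i j) : strongSetoid Y i j :=
  hij.imp id fun h' => ⟨h'.1.mono (entry_mono h i j), h'.2.mono (entry_mono h j i)⟩

/-- The identity map on indices induces a map between the strong components. -/
def componentMap {X Y : RelSubsemigroup (nonzero G n)} (h : X ≤ Y) :
    Quotient (strongSetoid X) → Quotient (strongSetoid Y) :=
  Quotient.map' id fun _ _ => strongSetoid_mono h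

theorem componentMap_surjective {X Y : RelSubsemigroup (nonzero G n)} (h : X ≤ Y) :
    Function.Surjective (componentMap h) := by
  rintro ⟨i⟩
  exact ⟨Quotient.mk _ i, rfl⟩

theorem card_components_le {X Y : RelSubsemigroup (nonzero G n)} (h : X ≤ Y) :
    Nat.card (Quotient (strongSetoid Y)) ≤ Nat.card (Quotient (strongSetoid X)) :=
  Nat.card_le_card_of_surjective _ (componentMap_surjective h)

/-- A surjection between finite sets that does not reduce the cardinality is injective, so no
components were merged. -/
theorem strongSetoid_of_card_le {X Y : RelSubsemigroup (nonzero G n)} (h : X ≤ Y)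
    (hc : Nat.card (Quotient (strongSetoid X)) ≤ Nat.card (Quotient (strongSetoid Y)))
    {i j : Fin n} (hij : strongSetoid Y i j) : strongSetoid X i j := by
  have hb := (componentMap_surjective h).bijective_of_nat_card_le hc
  exact Quotient.exact (hb.1 (a₁ := Quotient.mk _ i) (a₂ := Quotient.mk _ j)
    (Quotient.sound hij))

/-- A strictly monotone function that bounds the length of chains of subsemigroups. -/
noncomputable def potential (X : RelSubsemigroup (nonzero G n)) : ℕ :=
  ∑ i, natHeight (diagonal X i) + ∑ i, ∑ j ∈ Finset.Ioi i, pairWeight X.1 i j +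
    (n - Nat.card (Quotient (strongSetoid X)))

end Semigroup

section Group

variable [Group G]

/-- The elements in position `(i, j)` with `i ≤ j` or `i, j ≤ k`. -/
def blockTriangular (k : Fin n) : RelSubsemigroup (nonzero G n) :=
  ⟨{x | ∃ i g j, (i ≤ j ∨ i ≤ k ∧ j ≤ k) ∧ x = elt i g j}, by
    rintro _ ⟨i, g, j, -, rfl⟩
    exact elt_mem_nonzero _ _ _, by
    rintro _ ⟨i, g, j, hij, rfl⟩ _ ⟨j', h, l, hjl, rfl⟩ hm
    rw [elt_mul_elt_mem_nonzero] at hm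
    subst hm
    rw [elt_mul_elt, if_pos rfl]
    exact ⟨i, _, l, by omega, rfl⟩⟩

theorem blockTriangular_strictMono : StrictMono (blockTriangular (G := G) (n := n)) := by
  intro k k' hk
  refine lt_of_le_of_ne ?_ ?_
  · rintro _ ⟨i, g, j, hij, rfl⟩
    exact ⟨i, g, j, by omega, rfl⟩
  · intro h
    have : elt k' (1 : G) k ∈ (blockTriangular (G := G) k).1 :=
      h ▸ ⟨k', 1, k, Or.inr ⟨le_rfl, hk.le⟩, rfl⟩
    obtain ⟨i, g, j, hij, h⟩ := this
    cases h
    omega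

variable [Finite G]

/-- For `y` in the larger entry, `a` in position `(i, j)` and `b` in position `(j, i)` of `X`, the
product `y * b` is diagonal, hence in `X`. So `X` contains `y * (b * a) ^ (m + 1)` for all `m`, and
`b * a` has finite order. -/
theorem entry_eq_of_strongSetoid {X Y : RelSubsemigroup (nonzero G n)} (h : X ≤ Y)
    {i j : Fin n} (hii : entry X.1 i i = entry Y.1 i i) (hij : (entry X.1 i j).Nonempty)
    (hji : (entry X.1 j i).Nonempty) : entry X.1 i j = entry Y.1 i j := by
  refine (entry_mono h i j).antisymm fun y hy => ?_
  obtain ⟨a, ha⟩ := hij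
  obtain ⟨b, hb⟩ := hji
  have key : ∀ m : ℕ, y * (b * a) ^ (m + 1) ∈ entry X.1 i j := by
    intro m
    induction m with
    | zero =>
      rw [zero_add, pow_one, ← mul_assoc]
      exact mul_mem_entry X (hii ▸ mul_mem_entry Y hy (entry_mono h j i hb)) ha
    | succ m ih =>
      rw [pow_succ, ← mul_assoc]
      exact mul_mem_entry X ih (mul_mem_entry X hb ha)
  have := key (orderOf (b * a) - 1)
  rwa [Nat.sub_add_cancel (orderOf_pos _), pow_orderOf_eq_one, mul_one] at this

theorem potential_strictMono : StrictMono (potential (G := G) (n := n)) := by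
  intro X Y hXY
  have hle : X ≤ Y := hXY.le
  have hd : ∀ i ∈ Finset.univ, natHeight (diagonal X i) ≤ natHeight (diagonal Y i) :=
    fun i _ => natHeight_strictMono.monotone (entry_mono hle i i)
  have hw : ∀ i ∈ Finset.univ, ∀ j ∈ Finset.Ioi i, pairWeight X.1 i j ≤ pairWeight Y.1 i j :=
    fun i _ j _ => pairWeight_mono hle i j
  have hd' := Finset.sum_le_sum hd
  have hw' := Finset.sum_le_sum fun i hi => Finset.sum_le_sum (hw i hi)
  have hc := card_components_le hle
  -- This prevents truncation in `n - Nat.card _`, so equal differences do mean equal numbers of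
  -- components.
  have hn : Nat.card (Quotient (strongSetoid X)) ≤ n := by
    simpa using Nat.card_le_card_of_surjective (Quotient.mk (strongSetoid X)) Quotient.mk_surjective
  by_contra hlt
  rw [potential, potential] at hlt
  have hd2 := (Finset.sum_eq_sum_iff_of_le hd).1 (by omega)
  have hw2 := (Finset.sum_eq_sum_iff_of_le fun i hi => Finset.sum_le_sum (hw i hi)).1 (by omega)
  have hw3 : ∀ i j, i < j → pairWeight X.1 i j = pairWeight Y.1 i j := fun i j hij =>
    (Finset.sum_eq_sum_iff_of_le (hw i (Finset.mem_univ _))).1 (hw2 i (Finset.mem_univ _)) j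
      (Finset.mem_Ioi.2 hij)
  have hdiag : ∀ i, entry X.1 i i = entry Y.1 i i := by
    intro i
    by_contra hne
    exact (natHeight_strictMono (lt_of_le_of_ne
      (show diagonal X i ≤ diagonal Y i from entry_mono hle i i)
      fun h => hne (congrArg Subtype.val h))).ne (hd2 i (Finset.mem_univ _))
  have hentry : ∀ i j, entry X.1 i j = entry Y.1 i j := by
    intro i j
    by_cases hij : i = j
    · exact hij ▸ hdiag i
    by_cases hs : strongSetoid Y i j
    · obtain ⟨h1, h2⟩ := (strongSetoid_of_card_le hle (by omega) hs).resolve_left hij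
      exact entry_eq_of_strongSetoid hle (hdiag i) h1 h2
    · have hs' : ¬ ((entry Y.1 i j).Nonempty ∧ (entry Y.1 j i).Nonempty) := fun h =>
        hs (Or.inr h)
      rcases lt_or_gt_of_ne hij with hlt | hlt
      · exact (entry_eq_of_pairWeight_eq hle hs' (hw3 i j hlt)).1
      · exact (entry_eq_of_pairWeight_eq hle (fun h => hs' h.symm) (hw3 j i hlt)).2
  refine hXY.not_ge ?_
  rintro (_ | ⟨i, g, j⟩) hx
  · exact absurd rfl (Y.2.1 hx)
  · have : g ∈ entry Y.1 i j := hx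
    rwa [← hentry i j] at this

theorem relLength_nonzero_le [NeZero n] :
    relLength (nonzero G n) ≤
      n * relLength (Set.univ : Set G) + n.choose 2 * Nat.card G + (n - 1) := by
  refine (relLength_le_of_strictMono _ potential_strictMono).trans ?_
  rw [potential]
  -- At least one component remains, so there are at most `n - 1` mergers.
  have hc : 0 < Nat.card (Quotient (strongSetoid (RelSubsemigroup.full (nonzero G n)))) :=
    have : Nonempty (Quotient (strongSetoid (RelSubsemigroup.full (nonzero G n)))) :=
      ⟨Quotient.mk _ 0⟩
    Nat.card_pos
  refine Nat.add_le_add (Nat.add_le_add ?_ ?_) (by omega)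
  · refine (Finset.sum_le_card_nsmul _ _ (relLength (Set.univ : Set G)) fun i _ =>
      natHeight_strictMono.monotone (Set.subset_univ _)).trans (by simp)
  · rw [← Fin.sum_card_Ioi, Finset.sum_mul]
    refine Finset.sum_le_sum fun i _ => ?_
    exact Finset.sum_le_card_nsmul _ _ _ fun j _ => pairWeight_le _ i j

variable (G n) in
/-- The upper triangular elements of a Brandt semigroup. -/
def upperTriangular : Set (BrandtSemigroup G n) := {x | ∃ i g j, i ≤ j ∧ x = elt i g j}

theorem relLength_upperTriangular [NeZero n] :
    relLength (upperTriangular G n) =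
      n * relLength (Set.univ : Set G) + n.choose 2 * Nat.card G := by
  -- Multiplying upper triangular elements lowers the row index and raises the column index, hence
  -- the dual order on columns. The value at `zero` plays no role.
  let π : BrandtSemigroup G n → Fin n × (Fin n)ᵒᵈ := fun x =>
    x.casesOn (0, OrderDual.toDual 0) fun i _ j => (i, OrderDual.toDual j)
  rw [relLength_eq_sum_fibers π, Fintype.sum_prod_type]
  · have hfib : ∀ i j : Fin n, relLength (upperTriangular G n ∩ π ⁻¹' {(i, OrderDual.toDual j)}) =
        (if i = j then relLength (Set.univ : Set G) else 0) +
          if i < j then Nat.card G else 0 := by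
      intro i j
      rcases lt_trichotomy i j with hij | rfl | hij
      · have : upperTriangular G n ∩ π ⁻¹' {(i, OrderDual.toDual j)} =
            (fun g => elt i g j) '' Set.univ := by
          ext x
          constructor
          · rintro ⟨⟨i', g, j', hle, rfl⟩, h⟩
            simp only [π, Set.mem_preimage, Set.mem_singleton_iff, Prod.mk.injEq,
              OrderDual.toDual_inj] at h
            exact ⟨g, trivial, by rw [h.1, h.2]⟩
          · rintro ⟨g, -, rfl⟩
            exact ⟨⟨i, g, j, hij.le, rfl⟩, rfl⟩
        rw [this, relLength_of_mul_notMem, Set.ncard_image_of_injective, Set.ncard_univ,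
          if_neg hij.ne, if_pos hij, zero_add]
        · intro g h hgh
          simpa using hgh
        · rintro _ ⟨g, -, rfl⟩ _ ⟨h, -, rfl⟩
          simp [elt_mul_elt, hij.ne']
      · rw [if_pos rfl, if_neg (lt_irrefl _), add_zero]
        symm
        apply relLength_eq_of_equivOn (fun g => elt i g i)
        · refine ⟨fun g _ => ⟨⟨i, g, i, le_rfl, rfl⟩, rfl⟩, fun g _ h _ hgh => by simpa using hgh, ?_⟩
          rintro _ ⟨⟨i', g, j', hle, rfl⟩, h⟩
          simp only [π, Set.mem_preimage, Set.mem_singleton_iff, Prod.mk.injEq,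
            OrderDual.toDual_inj] at h
          exact ⟨g, trivial, by simp only [h.1, h.2]⟩
        · intro g _ h _
          simp only [elt_mul_elt, if_true, Set.mem_univ, iff_true]
          exact ⟨⟨i, _, i, le_rfl, rfl⟩, rfl⟩
        · intro g _ h _ _
          simp [elt_mul_elt]
      · have : upperTriangular G n ∩ π ⁻¹' {(i, OrderDual.toDual j)} = ∅ := by
          rw [Set.eq_empty_iff_forall_notMem]
          rintro _ ⟨⟨i', g, j', hle, rfl⟩, h⟩
          simp only [π, Set.mem_preimage, Set.mem_singleton_iff, Prod.mk.injEq,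
            OrderDual.toDual_inj] at h
          exact absurd (h.1 ▸ h.2 ▸ hle) (not_le.2 hij)
        rw [this, relLength_empty, if_neg hij.ne', if_neg hij.asymm]
    have hsum : ∀ i : Fin n, ∑ j : (Fin n)ᵒᵈ, relLength (upperTriangular G n ∩ π ⁻¹' {(i, j)}) =
        relLength (Set.univ : Set G) + (Finset.Ioi i).card * Nat.card G := by
      intro i
      rw [← OrderDual.toDual.sum_comp]
      simp only [hfib, Finset.sum_add_distrib, Finset.sum_ite_eq, Finset.mem_univ, if_true]
      rw [← Finset.sum_filter, Finset.sum_const, smul_eq_mul]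
      congr 3
      ext j
      simp
    simp only [hsum, Finset.sum_add_distrib, ← Finset.sum_mul, Fin.sum_card_Ioi]
    simp
  · rintro _ ⟨i, g, j, hij, rfl⟩ _ ⟨k, h, l, hkl, rfl⟩ hmem
    by_cases hjk : j = k
    · subst hjk
      simp only [elt_mul_elt, if_true, π, Prod.mk_le_mk, OrderDual.toDual_le_toDual]
      exact ⟨⟨le_rfl, hkl⟩, hij, le_rfl⟩
    · exfalso
      rw [elt_mul_elt, if_neg hjk] at hmem
      obtain ⟨_, _, _, _, h⟩ := hmem
      cases h

theorem relLength_nonzero [NeZero n] :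
    relLength (nonzero G n) =
      n * relLength (Set.univ : Set G) + n.choose 2 * Nat.card G + (n - 1) := by
  refine le_antisymm relLength_nonzero_le ?_
  have hpos := NeZero.pos n
  rw [← relLength_upperTriangular]
  -- A longest chain of upper triangular subsets is followed by the sets `blockTriangular k`, whose
  -- last index `n - 1` has height `n - 1` in `Fin n`.
  refine (Nat.add_le_add_right (relLength_le_natHeight ?_ ?_) _).trans <|
    (Nat.add_le_add_left (natHeight_fin (⟨n - 1, by omega⟩ : Fin n)).ge _).trans <|
    (natHeight_add_le _ (blockTriangular_strictMono (G := G)) _ ?_ _).trans <|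
    natHeight_strictMono.monotone (b := RelSubsemigroup.full _)
      (blockTriangular (⟨n - 1, by omega⟩ : Fin n)).2.1
  · rintro _ ⟨i, g, j, -, rfl⟩
    exact elt_mem_nonzero _ _ _
  · rintro _ ⟨i, g, j, hij, rfl⟩ _ ⟨j', h, l, hjl, rfl⟩ hm
    rw [elt_mul_elt_mem_nonzero] at hm
    subst hm
    rw [elt_mul_elt, if_pos rfl]
    exact ⟨i, _, l, hij.trans hjl, rfl⟩
  · rintro k _ ⟨i, g, j, hij, rfl⟩
    exact ⟨i, g, j, Or.inl hij, rfl⟩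

end Group

end BrandtSemigroup

/-! ### Principal ideals in finite semigroups. -/

section PrincipalIdeals

variable {S : Type*} [Semigroup S]

theorem mem_principalIdeal_self (x : S) : x ∈ principalIdeal x := ⟨1, 1, by simp⟩

theorem principalIdeal_subset_iff {x y : S} :
    principalIdeal x ⊆ principalIdeal y ↔ x ∈ principalIdeal y := by
  refine ⟨fun h => h (mem_principalIdeal_self x), ?_⟩
  rintro ⟨a, b, hx⟩ z ⟨c, d, hz⟩
  exact ⟨c * a, b * d, by rw [hz, hx]; simp only [mul_assoc]⟩

theorem principalIdeal_mul_subset_left (x y : S) : principalIdeal (x * y) ⊆ principalIdeal x :=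
  principalIdeal_subset_iff.2 ⟨1, y, by simp⟩

theorem principalIdeal_mul_subset_right (x y : S) : principalIdeal (x * y) ⊆ principalIdeal y :=
  principalIdeal_subset_iff.2 ⟨x, 1, by simp⟩

theorem principalLeftIdeal_subset_iff {x y : S} :
    principalLeftIdeal x ⊆ principalLeftIdeal y ↔ x ∈ principalLeftIdeal y := by
  refine ⟨fun h => h ⟨1, by simp⟩, ?_⟩
  rintro ⟨a, hx⟩ z ⟨c, hz⟩
  exact ⟨c * a, by rw [hz, hx]; simp only [mul_assoc]⟩

theorem principalRightIdeal_subset_iff {x y : S} :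
    principalRightIdeal x ⊆ principalRightIdeal y ↔ x ∈ principalRightIdeal y := by
  refine ⟨fun h => h ⟨1, by simp⟩, ?_⟩
  rintro ⟨a, hx⟩ z ⟨c, hz⟩
  exact ⟨a * c, by rw [hz, hx]; simp only [mul_assoc]⟩

theorem principalLeftIdeal_subset_of_eq_mul {x y a : S} (h : x = a * y) :
    principalLeftIdeal x ⊆ principalLeftIdeal y :=
  principalLeftIdeal_subset_iff.2 ⟨a, by rw [h]; simp⟩

theorem principalRightIdeal_subset_of_eq_mul {x y a : S} (h : x = y * a) :
    principalRightIdeal x ⊆ principalRightIdeal y :=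
  principalRightIdeal_subset_iff.2 ⟨a, by rw [h]; simp⟩

/-- In a finite semigroup an idempotent below a `J`-equivalent one is equal to it. -/
theorem idempotent_eq_of_principalIdeal_eq [Finite S] {f g : S} (hf : f * f = f) (hg : g * g = g)
    (hfg : f * g = g) (hgf : g * f = g) (h : principalIdeal f = principalIdeal g) : g = f := by
  obtain ⟨a, b, hab⟩ : f ∈ principalIdeal g := h ▸ mem_principalIdeal_self f
  -- Between `f` and `g`, even an adjoined identity gives a product in `S`.
  obtain ⟨p, hp⟩ : ∃ p : S, (p : WithOne S) = f * a * g := by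
    induction a with
    | one => exact ⟨f * g, by simp⟩
    | coe a => exact ⟨f * a * g, by simp⟩
  obtain ⟨q, hq⟩ : ∃ q : S, (q : WithOne S) = g * b * f := by
    induction b with
    | one => exact ⟨g * f, by simp⟩
    | coe b => exact ⟨g * b * f, by simp⟩
  have hf' : (f : WithOne S) * f = f := by rw [← WithOne.coe_mul, hf]
  have hg' : (g : WithOne S) * g = g := by rw [← WithOne.coe_mul, hg]
  have hpq : p * q = f := by
    apply WithOne.coe_injective
    rw [WithOne.coe_mul, hp, hq]
    calc (f : WithOne S) * a * g * (g * b * f) = f * (a * (g * g) * b) * f := by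
          simp only [mul_assoc]
      _ = f := by rw [hg', ← hab, hf', hf']
  have hgq : g * q = q := by
    apply WithOne.coe_injective
    rw [WithOne.coe_mul, hq, ← mul_assoc, ← mul_assoc, hg']
  have hfq : f * q = q := by rw [← hgq, ← mul_assoc, hfg]
  -- Since `p * q = f`, left multiplication by `q` is injective on this finite set, hence
  -- surjective. So `f = q * s` for some `s`, and `g * q = q` gives `g * f = f`.
  have hmaps : Set.MapsTo (q * ·) {s | f * s = s} {s | f * s = s} := fun s _ => by
    simp only [Set.mem_ofPred_eq, ← mul_assoc, hfq]
  have hinj : Set.InjOn (q * ·) {s | f * s = s} := by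
    intro s hs t ht hst
    have := congrArg (p * ·) hst
    simp only [← mul_assoc, hpq] at this
    rwa [show f * s = s from hs, show f * t = t from ht] at this
  obtain ⟨s, -, hs⟩ := (((Set.toFinite _).injOn_iff_bijOn_of_mapsTo hmaps).1 hinj).surjOn
    (show f ∈ {s | f * s = s} from hf)
  have hs' : q * s = f := hs
  rw [← hgf, ← hs', ← mul_assoc, hgq]

end PrincipalIdeals


/-- Maximal subgroups carry only a semigroup instance; the group structure is built over that same
multiplication. -/
theorem BrandtSemigroup.relLength_nonzero_of_isGroup {G : Type*} [Semigroup G] [Finite G]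
    (hG : ∃ e : G, (∀ a, e * a = a ∧ a * e = a) ∧ ∀ a, ∃ b, a * b = e ∧ b * a = e)
    (n : ℕ) [NeZero n] :
    relLength (nonzero G n) =
      n * relLength (Set.univ : Set G) + n.choose 2 * Nat.card G + (n - 1) := by
  choose e he b hb using hG
  let _ : Group G :=
    { ‹Semigroup G› with
      one := e
      one_mul := fun a => (he a).1
      mul_one := fun a => (he a).2
      inv := b
      inv_mul_cancel := fun a => (hb a).2 }
  exact relLength_nonzero

/-! ### Finite inverse semigroups and their `J`-classes. -/

namespace IsInverseSemigroup

variable {S : Type*} [Semigroup S]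

/-- The inverse of an element of an inverse semigroup. -/
noncomputable def inv (hS : IsInverseSemigroup S) (x : S) : S := (hS x).choose

theorem mul_inv_mul (hS : IsInverseSemigroup S) (x : S) : x * hS.inv x * x = x :=
  (hS x).choose_spec.1.1

theorem inv_mul_inv (hS : IsInverseSemigroup S) (x : S) : hS.inv x * x * hS.inv x = hS.inv x :=
  (hS x).choose_spec.1.2

theorem eq_inv (hS : IsInverseSemigroup S) {x y : S} (h1 : x * y * x = x) (h2 : y * x * y = y) :
    y = hS.inv x :=
  (hS x).choose_spec.2 y ⟨h1, h2⟩

theorem inv_inv (hS : IsInverseSemigroup S) (x : S) : hS.inv (hS.inv x) = x :=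
  (hS.eq_inv (hS.inv_mul_inv x) (hS.mul_inv_mul x)).symm

theorem inv_eq_self (hS : IsInverseSemigroup S) {e : S} (he : e * e = e) : hS.inv e = e :=
  (hS.eq_inv (by rw [he, he]) (by rw [he, he])).symm

theorem mul_inv_idem (hS : IsInverseSemigroup S) (x : S) :
    x * hS.inv x * (x * hS.inv x) = x * hS.inv x := by
  rw [← mul_assoc, hS.mul_inv_mul]

theorem inv_mul_idem (hS : IsInverseSemigroup S) (x : S) :
    hS.inv x * x * (hS.inv x * x) = hS.inv x * x := by
  rw [← mul_assoc, hS.inv_mul_inv]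

/-- If `x` is the inverse of `e * f`, then so is `f * x * e`; by uniqueness they agree, which makes
`x` idempotent, hence its own inverse, hence equal to `e * f`. -/
theorem mul_idem (hS : IsInverseSemigroup S) {e f : S} (he : e * e = e) (hf : f * f = f) :
    e * f * (e * f) = e * f := by
  set x := hS.inv (e * f) with hx
  have h1 : e * f * x * (e * f) = e * f := hS.mul_inv_mul _
  have h2 : x * (e * f) * x = x := hS.inv_mul_inv _
  have h3 : f * x * e = x := by
    refine hS.eq_inv ?_ ?_
    · calc e * f * (f * x * e) * (e * f) = e * (f * f) * x * ((e * e) * f) := by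
            simp only [mul_assoc]
        _ = e * f := by rw [he, hf, h1]
    · calc f * x * e * (e * f) * (f * x * e) = f * (x * ((e * e) * (f * f)) * x) * e := by
            simp only [mul_assoc]
        _ = f * x * e := by rw [he, hf, h2]
  have h4 : x * x = x := by
    calc x * x = f * x * e * (f * x * e) := by rw [h3]
      _ = f * (x * (e * f) * x) * e := by simp only [mul_assoc]
      _ = x := by rw [h2, h3]
  have h5 : e * f = x := by
    rw [← hS.inv_inv (e * f), ← hx, hS.inv_eq_self h4]
  rw [h5, h4]

theorem idem_comm (hS : IsInverseSemigroup S) {e f : S} (he : e * e = e) (hf : f * f = f) :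
    e * f = f * e := by
  have h1 := hS.mul_idem he hf
  have h2 := hS.mul_idem hf he
  rw [← hS.inv_eq_self h1]
  symm
  refine hS.eq_inv ?_ ?_
  · calc e * f * (f * e) * (e * f) = e * (f * f) * (e * e) * f := by simp only [mul_assoc]
      _ = e * f * (e * f) := by rw [he, hf]; simp only [mul_assoc]
      _ = e * f := h1
  · calc f * e * (e * f) * (f * e) = f * (e * e) * (f * f) * e := by simp only [mul_assoc]
      _ = f * e * (f * e) := by rw [he, hf]; simp only [mul_assoc]
      _ = f * e := h2

theorem inv_mul_rev (hS : IsInverseSemigroup S) (x y : S) :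
    hS.inv (x * y) = hS.inv y * hS.inv x := by
  have hc := hS.idem_comm (hS.inv_mul_idem x) (hS.mul_inv_idem y)
  symm
  refine hS.eq_inv ?_ ?_
  · calc x * y * (hS.inv y * hS.inv x) * (x * y)
        = x * (y * hS.inv y * (hS.inv x * x)) * y := by simp only [mul_assoc]
      _ = x * hS.inv x * x * (y * hS.inv y * y) := by rw [← hc]; simp only [mul_assoc]
      _ = x * y := by rw [hS.mul_inv_mul, hS.mul_inv_mul]
  · calc hS.inv y * hS.inv x * (x * y) * (hS.inv y * hS.inv x)
        = hS.inv y * (hS.inv x * x * (y * hS.inv y)) * hS.inv x := by simp only [mul_assoc]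
      _ = hS.inv y * y * hS.inv y * (hS.inv x * x * hS.inv x) := by
          rw [hc]; simp only [mul_assoc]
      _ = hS.inv y * hS.inv x := by rw [hS.inv_mul_inv, hS.inv_mul_inv]

theorem mul_of_mem_principalLeftIdeal (hS : IsInverseSemigroup S) {x y : S}
    (h : x ∈ principalLeftIdeal y) : x * (hS.inv y * y) = x := by
  obtain ⟨a, ha⟩ := h
  apply WithOne.coe_injective
  rw [WithOne.coe_mul, ha, mul_assoc, ← WithOne.coe_mul, ← mul_assoc, hS.mul_inv_mul]

theorem mul_of_mem_principalRightIdeal (hS : IsInverseSemigroup S) {x y : S}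
    (h : x ∈ principalRightIdeal y) : y * hS.inv y * x = x := by
  obtain ⟨a, ha⟩ := h
  apply WithOne.coe_injective
  rw [WithOne.coe_mul, ha, ← mul_assoc, ← WithOne.coe_mul, hS.mul_inv_mul]

theorem greenL_iff (hS : IsInverseSemigroup S) (x y : S) :
    greenL S x y ↔ hS.inv x * x = hS.inv y * y := by
  constructor
  · intro h
    have h : principalLeftIdeal x = principalLeftIdeal y := h
    have h1 := hS.mul_of_mem_principalLeftIdeal (principalLeftIdeal_subset_iff.1 h.subset)
    have h2 := hS.mul_of_mem_principalLeftIdeal (principalLeftIdeal_subset_iff.1 h.superset)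
    calc hS.inv x * x = hS.inv x * x * (hS.inv y * y) := by rw [mul_assoc, h1]
      _ = hS.inv y * y * (hS.inv x * x) := hS.idem_comm (hS.inv_mul_idem x) (hS.inv_mul_idem y)
      _ = hS.inv y * y := by rw [mul_assoc, h2]
  · intro h
    change principalLeftIdeal x = principalLeftIdeal y
    apply Set.Subset.antisymm
    · apply principalLeftIdeal_subset_of_eq_mul (a := x * hS.inv y)
      rw [mul_assoc, ← h, ← mul_assoc, hS.mul_inv_mul]
    · apply principalLeftIdeal_subset_of_eq_mul (a := y * hS.inv x)
      rw [mul_assoc, h, ← mul_assoc, hS.mul_inv_mul]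

theorem greenR_iff (hS : IsInverseSemigroup S) (x y : S) :
    greenR S x y ↔ x * hS.inv x = y * hS.inv y := by
  constructor
  · intro h
    have h : principalRightIdeal x = principalRightIdeal y := h
    have h1 := hS.mul_of_mem_principalRightIdeal (principalRightIdeal_subset_iff.1 h.subset)
    have h2 := hS.mul_of_mem_principalRightIdeal (principalRightIdeal_subset_iff.1 h.superset)
    calc x * hS.inv x = y * hS.inv y * (x * hS.inv x) := by rw [← mul_assoc, h1]
      _ = x * hS.inv x * (y * hS.inv y) := hS.idem_comm (hS.mul_inv_idem y) (hS.mul_inv_idem x)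
      _ = y * hS.inv y := by rw [← mul_assoc, h2]
  · intro h
    change principalRightIdeal x = principalRightIdeal y
    apply Set.Subset.antisymm
    · apply principalRightIdeal_subset_of_eq_mul (a := hS.inv y * x)
      rw [← mul_assoc, ← h, hS.mul_inv_mul]
    · apply principalRightIdeal_subset_of_eq_mul (a := hS.inv x * y)
      rw [← mul_assoc, h, hS.mul_inv_mul]

theorem principalIdeal_mul_inv (hS : IsInverseSemigroup S) (x : S) :
    principalIdeal (x * hS.inv x) = principalIdeal x := by
  refine (principalIdeal_mul_subset_left _ _).antisymm ?_
  conv_lhs => rw [← hS.mul_inv_mul x]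
  exact principalIdeal_mul_subset_left _ _

theorem principalIdeal_inv_mul (hS : IsInverseSemigroup S) (x : S) :
    principalIdeal (hS.inv x * x) = principalIdeal x := by
  refine (principalIdeal_mul_subset_right _ _).antisymm ?_
  conv_lhs => rw [← hS.mul_inv_mul x, mul_assoc]
  exact principalIdeal_mul_subset_right _ _

/-- Writing `e = x * f * y`, take `a = e * x * f`. Then `hS.inv a * a` is an idempotent below `f`
and `J`-equivalent to it, so finiteness forces equality. -/
theorem exists_mul_inv_eq_inv_mul_eq [Finite S] (hS : IsInverseSemigroup S) {e f : S}
    (he : e * e = e) (hf : f * f = f) (h : principalIdeal e = principalIdeal f) :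
    ∃ a, a * hS.inv a = e ∧ hS.inv a * a = f := by
  obtain ⟨x, y, hxy⟩ : e ∈ principalIdeal f := h ▸ mem_principalIdeal_self e
  obtain ⟨a, ha⟩ : ∃ a : S, (a : WithOne S) = e * x * f := by
    induction x with
    | one => exact ⟨e * f, by simp⟩
    | coe x => exact ⟨e * x * f, by simp⟩
  obtain ⟨b, hb⟩ : ∃ b : S, (b : WithOne S) = f * y * e := by
    induction y with
    | one => exact ⟨f * e, by simp⟩
    | coe y => exact ⟨f * y * e, by simp⟩
  have he' : (e : WithOne S) * e = e := by rw [← WithOne.coe_mul, he]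
  have hf' : (f : WithOne S) * f = f := by rw [← WithOne.coe_mul, hf]
  have hab : a * b = e := by
    apply WithOne.coe_injective
    rw [WithOne.coe_mul, ha, hb]
    calc (e : WithOne S) * x * f * (f * y * e) = e * (x * (f * f) * y) * e := by
          simp only [mul_assoc]
      _ = e := by rw [hf', ← hxy, he', he']
  have hea : e * a = a := by
    apply WithOne.coe_injective
    rw [WithOne.coe_mul, ha, ← mul_assoc, ← mul_assoc, he']
  have haf : a * f = a := by
    apply WithOne.coe_injective
    rw [WithOne.coe_mul, ha, mul_assoc, hf']
  have h1 : a * hS.inv a = e := by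
    calc a * hS.inv a = e * (a * hS.inv a) := by rw [← mul_assoc, hea]
      _ = a * hS.inv a * e := hS.idem_comm he (hS.mul_inv_idem a)
      _ = e := by rw [← hab, ← mul_assoc, hS.mul_inv_mul]
  have h2 : hS.inv a * a * f = hS.inv a * a := by rw [mul_assoc, haf]
  refine ⟨a, h1, idempotent_eq_of_principalIdeal_eq hf (hS.inv_mul_idem a) ?_ h2 ?_⟩
  · rw [← hS.idem_comm (hS.inv_mul_idem a) hf, h2]
  · rw [hS.principalIdeal_inv_mul, ← hS.principalIdeal_mul_inv a, h1, h]

/-- The idempotents that generate a given two-sided ideal. -/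
def _root_.idempotentsOver {S : Type*} [Semigroup S] (I : Set S) : Set S :=
  {f | f * f = f ∧ principalIdeal f = I}

/-- Each class contains exactly one idempotent, namely `s x`. Taking `s x` to be `x⁻¹x` or `xx⁻¹`
covers `L` and `R` alike, whence the two counts agree. -/
theorem ncard_classes_eq {r : Setoid S} {s : S → S} (hr : ∀ x y, r x y ↔ s x = s y)
    (hs : ∀ x, s x * s x = s x) (hJ : ∀ x, principalIdeal (s x) = principalIdeal x)
    (hid : ∀ f, f * f = f → s f = f) (I : Set S) :
    {C : Set S | C ∈ r.classes ∧ C ⊆ principalIdeal ⁻¹' {I}}.ncard =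
      (idempotentsOver I).ncard := by
  have : {C : Set S | C ∈ r.classes ∧ C ⊆ principalIdeal ⁻¹' {I}} =
      (fun f => {x | s x = f}) '' idempotentsOver I := by
    ext C
    constructor
    · rintro ⟨⟨y, rfl⟩, hC⟩
      refine ⟨s y, ⟨hs y, (hJ y).trans (hC (r.refl y))⟩, ?_⟩
      ext x
      exact (hr x y).symm
    · rintro ⟨f, ⟨hf, hfI⟩, rfl⟩
      refine ⟨⟨f, ?_⟩, ?_⟩
      · ext x
        simp only [Set.mem_ofPred_eq, hr, hid f hf]
      · intro x hx
        have hx : s x = f := hx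
        exact (hJ x).symm.trans (hx ▸ hfI)
  rw [this]
  refine Set.InjOn.ncard_image ?_
  intro f hf g hg hfg
  have : f ∈ {x | s x = g} := (show {x | s x = f} = {x | s x = g} from hfg) ▸ hid f hf.1
  exact (hid f hf.1).symm.trans this

theorem numLClasses_eq (hS : IsInverseSemigroup S) (I : Set S) :
    numLClasses (principalIdeal ⁻¹' {I}) = (idempotentsOver I).ncard :=
  ncard_classes_eq hS.greenL_iff hS.inv_mul_idem hS.principalIdeal_inv_mul
    (fun f hf => by rw [hS.inv_eq_self hf, hf]) I

theorem numRClasses_eq (hS : IsInverseSemigroup S) (I : Set S) :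
    numRClasses (principalIdeal ⁻¹' {I}) = (idempotentsOver I).ncard :=
  ncard_classes_eq hS.greenR_iff hS.mul_inv_idem hS.principalIdeal_mul_inv
    (fun f hf => by rw [hS.inv_eq_self hf, hf]) I

/-- The maximal subgroup with identity `e`. -/
def maximalSubgroup (hS : IsInverseSemigroup S) (e : S) : Subsemigroup S where
  carrier := {x | x * hS.inv x = e ∧ hS.inv x * x = e}
  mul_mem' := by
    rintro x y ⟨hx, hx'⟩ ⟨hy, hy'⟩
    rw [Set.mem_ofPred_eq, hS.inv_mul_rev]
    constructor
    · calc x * y * (hS.inv y * hS.inv x) = x * (y * hS.inv y) * hS.inv x := by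
            simp only [mul_assoc]
        _ = e := by rw [hy, ← hx', ← mul_assoc, hS.mul_inv_mul, hx, hx']
    · calc hS.inv y * hS.inv x * (x * y) = hS.inv y * (hS.inv x * x) * y := by
            simp only [mul_assoc]
        _ = e := by rw [hx', ← hy, ← mul_assoc, hS.inv_mul_inv, hy', hy]

theorem mem_maximalSubgroup (hS : IsInverseSemigroup S) {e x : S} :
    x ∈ hS.maximalSubgroup e ↔ x * hS.inv x = e ∧ hS.inv x * x = e := Iff.rfl

theorem self_mem_maximalSubgroup (hS : IsInverseSemigroup S) {e : S} (he : e * e = e) :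
    e ∈ hS.maximalSubgroup e := by
  rw [mem_maximalSubgroup, hS.inv_eq_self he, he, and_self]

theorem inv_mem_maximalSubgroup (hS : IsInverseSemigroup S) {e x : S}
    (hx : x ∈ hS.maximalSubgroup e) : hS.inv x ∈ hS.maximalSubgroup e := by
  rw [mem_maximalSubgroup, hS.inv_inv]
  exact hx.symm

theorem mul_of_mem_maximalSubgroup (hS : IsInverseSemigroup S) {e x : S}
    (hx : x ∈ hS.maximalSubgroup e) : e * x = x ∧ x * e = x := by
  constructor
  · rw [← hx.1, hS.mul_inv_mul]
  · rw [← hx.2, ← mul_assoc, hS.mul_inv_mul]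

theorem principalIdeal_eq_of_mem (hS : IsInverseSemigroup S) {e x : S}
    (hx : x ∈ hS.maximalSubgroup e) : principalIdeal x = principalIdeal e := by
  rw [← hx.1, hS.principalIdeal_mul_inv]

theorem isGroup_maximalSubgroup (hS : IsInverseSemigroup S) {e : S} (he : e * e = e) :
    (hS.maximalSubgroup e).IsGroup :=
  ⟨e, hS.self_mem_maximalSubgroup he, fun _ ha => hS.mul_of_mem_maximalSubgroup ha,
    fun a ha => ⟨hS.inv a, hS.inv_mem_maximalSubgroup ha, ha⟩⟩

theorem exists_le_maximalSubgroup (hS : IsInverseSemigroup S) {H : Subsemigroup S}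
    (hH : H.IsGroup) : ∃ e ∈ H, e * e = e ∧ H ≤ hS.maximalSubgroup e := by
  obtain ⟨e, he, h1, h2⟩ := hH
  refine ⟨e, he, (h1 e he).1, fun a ha => ?_⟩
  obtain ⟨b, hb, hab, hba⟩ := h2 a ha
  have : b = hS.inv a := hS.eq_inv (by rw [hab, (h1 a ha).1]) (by rw [hba, (h1 b hb).1])
  exact ⟨this ▸ hab, this ▸ hba⟩

theorem isMaximalSubgroup_maximalSubgroup (hS : IsInverseSemigroup S) {e : S} (he : e * e = e) :
    (hS.maximalSubgroup e).IsMaximalSubgroup := by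
  refine ⟨hS.isGroup_maximalSubgroup he, fun K hK hle => ?_⟩
  obtain ⟨f, -, hf, hKf⟩ := hS.exists_le_maximalSubgroup hK
  have := (hKf (hle (hS.self_mem_maximalSubgroup he))).1
  rw [hS.inv_eq_self he, he] at this
  exact this ▸ hKf

theorem exists_eq_maximalSubgroup (hS : IsInverseSemigroup S) {H : Subsemigroup S}
    (hH : H.IsMaximalSubgroup) : ∃ e ∈ H, e * e = e ∧ H = hS.maximalSubgroup e := by
  obtain ⟨e, he, hee, hle⟩ := hS.exists_le_maximalSubgroup hH.1
  exact ⟨e, he, hee, hle.antisymm (hH.2 (hS.isGroup_maximalSubgroup hee) hle)⟩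

theorem conj_mul_inv (hS : IsInverseSemigroup S) {e a b g : S} (ha : a * hS.inv a = e)
    (hb : b * hS.inv b = e) (hg : g ∈ hS.maximalSubgroup e) :
    hS.inv a * g * b * hS.inv (hS.inv a * g * b) = hS.inv a * a := by
  rw [hS.inv_mul_rev, hS.inv_mul_rev, hS.inv_inv]
  calc hS.inv a * g * b * (hS.inv b * (hS.inv g * a))
      = hS.inv a * (g * (b * hS.inv b) * hS.inv g) * a := by simp only [mul_assoc]
    _ = hS.inv a * a := by
      rw [hb, (hS.mul_of_mem_maximalSubgroup hg).2, hg.1, ← ha, mul_assoc, hS.mul_inv_mul]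

theorem conj_inv_mul (hS : IsInverseSemigroup S) {e a b g : S} (ha : a * hS.inv a = e)
    (hb : b * hS.inv b = e) (hg : g ∈ hS.maximalSubgroup e) :
    hS.inv (hS.inv a * g * b) * (hS.inv a * g * b) = hS.inv b * b := by
  have h := hS.conj_mul_inv hb ha (hS.inv_mem_maximalSubgroup hg)
  have h2 : hS.inv (hS.inv a * g * b) = hS.inv b * hS.inv g * a := by
    rw [hS.inv_mul_rev, hS.inv_mul_rev, hS.inv_inv, mul_assoc]
  rw [← h2, hS.inv_inv] at h
  exact h

/-- A `J`-class of a finite inverse semigroup is the non-zero part of a Brandt semigroup. -/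
theorem relLength_jClass [Finite S] (hS : IsInverseSemigroup S) {e : S} (he : e * e = e) {n : ℕ}
    (hn : n = (idempotentsOver (principalIdeal e)).ncard) :
    relLength (principalIdeal ⁻¹' {principalIdeal e}) =
      relLength (BrandtSemigroup.nonzero (hS.maximalSubgroup e) n) := by
  obtain ⟨ε⟩ : Nonempty (Fin n ≃ idempotentsOver (principalIdeal e)) := by
    have h := Finite.equivFin (idempotentsOver (principalIdeal e))
    rw [Nat.card_coe_set_eq, ← hn] at h
    exact ⟨h.symm⟩
  choose a ha ha' using fun i => hS.exists_mul_inv_eq_inv_mul_eq he (ε i).2.1 (ε i).2.2.symm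
  -- The elements `a i` transport the idempotent `e` to `ε i`. From `x = φ (elt i g j)` one recovers
  -- `i` by `xx⁻¹ = ε i`, `j` by `x⁻¹x = ε j`, and `g` as `a i * x * (a j)⁻¹`. The value at `zero`
  -- is irrelevant.
  let φ : BrandtSemigroup (hS.maximalSubgroup e) n → S := fun x =>
    x.casesOn e fun i g j => hS.inv (a i) * g * a j
  have hφ : ∀ i g j, φ (.elt i g j) = hS.inv (a i) * g * a j := fun _ _ _ => rfl
  have hφ1 : ∀ i g j, φ (.elt i g j) * hS.inv (φ (.elt i g j)) = ε i := fun i g j => by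
    rw [hφ, hS.conj_mul_inv (ha i) (ha j) g.2, ha']
  have hφ2 : ∀ i g j, hS.inv (φ (.elt i g j)) * φ (.elt i g j) = ε j := fun i g j => by
    rw [hφ, hS.conj_inv_mul (ha i) (ha j) g.2, ha']
  have hφ3 : ∀ i g j, a i * φ (.elt i g j) * hS.inv (a j) = g := fun i g j => by
    calc a i * (hS.inv (a i) * g * a j) * hS.inv (a j)
        = a i * hS.inv (a i) * g * (a j * hS.inv (a j)) := by simp only [mul_assoc]
      _ = g := by
        rw [ha, ha, (hS.mul_of_mem_maximalSubgroup g.2).1, (hS.mul_of_mem_maximalSubgroup g.2).2]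
  have hφJ : ∀ i g j, principalIdeal (φ (.elt i g j)) = principalIdeal e := fun i g j => by
    rw [← hS.principalIdeal_mul_inv, hφ1]
    exact (ε i).2.2
  have hφmul : ∀ i g j h l, φ (.elt i g j) * φ (.elt j h l) = φ (.elt i (g * h) l) := by
    intro i g j h l
    calc hS.inv (a i) * g * a j * (hS.inv (a j) * h * a l)
        = hS.inv (a i) * (g * (a j * hS.inv (a j)) * h) * a l := by simp only [mul_assoc]
      _ = hS.inv (a i) * (g * h) * a l := by rw [ha, (hS.mul_of_mem_maximalSubgroup g.2).2]
  symm
  apply relLength_eq_of_equivOn φ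
  · refine ⟨?_, ?_, ?_⟩
    · rintro (_ | ⟨i, g, j⟩) hx
      · exact absurd rfl hx
      · exact hφJ i g j
    · rintro (_ | ⟨i, g, j⟩) hx (_ | ⟨k, h, l⟩) hy hxy
      · exact absurd rfl hx
      · exact absurd rfl hx
      · exact absurd rfl hy
      · obtain rfl : i = k := by
          apply ε.injective
          apply Subtype.ext
          rw [← hφ1 i g j, hxy, hφ1]
        obtain rfl : j = l := by
          apply ε.injective
          apply Subtype.ext
          rw [← hφ2 i g j, hxy, hφ2]
        congr 1
        apply Subtype.ext
        rw [← hφ3 i g j, hxy, hφ3]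
    · intro x hx
      have hx : principalIdeal x = principalIdeal e := hx
      obtain ⟨i, hi⟩ := ε.surjective ⟨x * hS.inv x, hS.mul_inv_idem x,
        (hS.principalIdeal_mul_inv x).trans hx⟩
      obtain ⟨j, hj⟩ := ε.surjective ⟨hS.inv x * x, hS.inv_mul_idem x,
        (hS.principalIdeal_inv_mul x).trans hx⟩
      have hi : hS.inv (a i) * a i = x * hS.inv x := (ha' i).trans (congrArg Subtype.val hi)
      have hj : hS.inv (a j) * a j = hS.inv x * x := (ha' j).trans (congrArg Subtype.val hj)
      have hg : a i * x * hS.inv (a j) ∈ hS.maximalSubgroup e := by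
        rw [mem_maximalSubgroup, hS.inv_mul_rev, hS.inv_mul_rev, hS.inv_inv]
        constructor
        · calc a i * x * hS.inv (a j) * (a j * (hS.inv x * hS.inv (a i)))
              = a i * (x * (hS.inv (a j) * a j) * hS.inv x) * hS.inv (a i) := by
                simp only [mul_assoc]
            _ = e := by
              rw [hj, ← mul_assoc x (hS.inv x) x, hS.mul_inv_mul, ← hi, ← mul_assoc, hS.mul_inv_mul, ha]
        · calc a j * (hS.inv x * hS.inv (a i)) * (a i * x * hS.inv (a j))
              = a j * (hS.inv x * (hS.inv (a i) * a i) * x) * hS.inv (a j) := by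
                simp only [mul_assoc]
            _ = e := by
              rw [hi, ← mul_assoc (hS.inv x) x (hS.inv x), hS.inv_mul_inv, ← hj, ← mul_assoc, hS.mul_inv_mul, ha]
      refine ⟨.elt i ⟨_, hg⟩ j, BrandtSemigroup.elt_mem_nonzero _ _ _, ?_⟩
      calc hS.inv (a i) * (a i * x * hS.inv (a j)) * a j
          = hS.inv (a i) * a i * x * (hS.inv (a j) * a j) := by simp only [mul_assoc]
        _ = x := by rw [hi, hj, hS.mul_inv_mul, ← mul_assoc, hS.mul_inv_mul]
  · rintro (_ | ⟨i, g, j⟩) hx (_ | ⟨k, h, l⟩) hy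
    · exact absurd rfl hx
    · exact absurd rfl hx
    · exact absurd rfl hy
    rw [BrandtSemigroup.elt_mul_elt_mem_nonzero]
    constructor
    -- The product factors through `ε j * ε k`, which therefore stays in the `J`-class. Being an
    -- idempotent below both `ε j` and `ε k`, it equals each of them.
    · intro hm
      have hm : principalIdeal (φ (.elt i g j) * φ (.elt k h l)) = principalIdeal e := hm
      set x := φ (.elt i g j) with hx
      set y := φ (.elt k h l) with hy
      have hj := (ε j).2
      have hk := (ε k).2
      have hxy : x * y = x * (((ε j : S) * ε k) * y) := by
        rw [← hφ2 i g j, ← hφ1 k h l, ← hx, ← hy]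
        calc x * y = x * hS.inv x * x * (y * hS.inv y * y) := by
              rw [hS.mul_inv_mul, hS.mul_inv_mul]
          _ = _ := by simp only [mul_assoc]
      have hid := hS.mul_idem hj.1 hk.1
      have hcomm := hS.idem_comm hj.1 hk.1
      have hJ : principalIdeal ((ε j : S) * ε k) = principalIdeal e := by
        apply Set.Subset.antisymm
        · exact (principalIdeal_mul_subset_left _ _).trans hj.2.subset
        · refine hm.superset.trans ?_
          rw [hxy]
          exact (principalIdeal_mul_subset_right _ _).trans (principalIdeal_mul_subset_left _ _)
      have h1 : (ε j : S) * ε k = ε j := by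
        apply idempotent_eq_of_principalIdeal_eq hj.1 hid
        · rw [← mul_assoc, hj.1]
        · rw [hcomm, mul_assoc, hj.1]
        · rw [hj.2, hJ]
      have h2 : (ε j : S) * ε k = ε k := by
        apply idempotent_eq_of_principalIdeal_eq hk.1 hid
        · rw [hcomm, ← mul_assoc, hk.1]
        · rw [mul_assoc, hk.1]
        · rw [hk.2, hJ]
      exact ε.injective (Subtype.ext (h1.symm.trans h2))
    · rintro rfl
      rw [hφmul]
      exact hφJ _ _ _
  · rintro (_ | ⟨i, g, j⟩) hx (_ | ⟨k, h, l⟩) hy hxy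
    · exact absurd rfl hx
    · exact absurd rfl hx
    · exact absurd rfl hy
    rw [BrandtSemigroup.elt_mul_elt_mem_nonzero] at hxy
    subst hxy
    rw [BrandtSemigroup.elt_mul_elt, if_pos rfl, hφmul]

end IsInverseSemigroup

/-! ### Summation over the `J`-classes. -/

theorem relLength_univ_eq_sum_jClasses {S : Type*} [Semigroup S] [Finite S] {m : ℕ}
    (J : Fin m ≃ {C : Set S // C ∈ (greenJ S).classes}) :
    relLength (Set.univ : Set S) = ∑ i, relLength (J i : Set S) := by
  classical
  cases nonempty_fintype S
  let π : S → Set.range (principalIdeal (S := S)) := fun x => ⟨principalIdeal x, x, rfl⟩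
  choose c hc using fun i => (J i).2
  have hJ : ∀ i, Set.univ ∩ π ⁻¹' {π (c i)} = (J i : Set S) := by
    intro i
    rw [hc, Set.univ_inter]
    ext x
    exact Subtype.ext_iff
  have hb : Function.Bijective fun i => π (c i) := by
    constructor
    · intro i j hij
      apply J.injective
      apply Subtype.ext
      rw [← hJ, ← hJ]
      exact congrArg (fun I => Set.univ ∩ π ⁻¹' {I}) hij
    · rintro ⟨_, x, rfl⟩
      refine ⟨J.symm ⟨_, (greenJ S).mem_classes x⟩, ?_⟩
      have : x ∈ (J (J.symm ⟨_, (greenJ S).mem_classes x⟩) : Set S) := by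
        rw [J.apply_symm_apply]
        exact (greenJ S).refl x
      rw [← hJ] at this
      exact this.2.symm
  rw [relLength_eq_sum_fibers π, ← hb.sum_comp]
  · exact Finset.sum_congr rfl fun i _ => by rw [hJ]
  · exact fun x _ y _ _ =>
      ⟨principalIdeal_mul_subset_left x y, principalIdeal_mul_subset_right x y⟩

theorem mainTheorem5 {S : Type*} [Semigroup S] [Finite S] (hS : IsInverseSemigroup S)
    (m : ℕ) (J : Fin m ≃ {C : Set S // C ∈ (greenJ S).classes})
    (n : Fin m → ℕ) (hn : ∀ i, n i = numLClasses (J i : Set S)) :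
    (∀ i, n i = numRClasses (J i : Set S)) ∧
    (∀ i, ∃ H : Subsemigroup S, H.IsMaximalSubgroup ∧ (H : Set S) ⊆ (J i : Set S)) ∧
    ∀ G : Fin m → Subsemigroup S,
      (∀ i, (G i).IsMaximalSubgroup ∧ (G i : Set S) ⊆ (J i : Set S)) →
        semigroupLength S = -1 + ∑ i, semigroupLength (BrandtSemigroup (G i) (n i)) ∧
        (semigroupLength S : ℚ) =
          -1 + ∑ i, ((n i : ℚ) * ((semigroupLength (G i) : ℚ) + 1)
            + (n i : ℚ) * ((n i : ℚ) - 1) / 2 * (Nat.card (G i) : ℚ)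
            + ((n i : ℚ) - 1)) := by
  have hJ : ∀ i, ∃ x, (J i : Set S) = principalIdeal ⁻¹' {principalIdeal x} := fun i => by
    obtain ⟨x, hx⟩ := (J i).2
    exact ⟨x, hx⟩
  refine ⟨fun i => ?_, fun i => ?_, fun G hG => ?_⟩
  · obtain ⟨x, hx⟩ := hJ i
    rw [hn, hx, hS.numLClasses_eq, hS.numRClasses_eq]
  · obtain ⟨x, hx⟩ := hJ i
    refine ⟨hS.maximalSubgroup (x * hS.inv x),
      hS.isMaximalSubgroup_maximalSubgroup (hS.mul_inv_idem x), fun y hy => ?_⟩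
    rw [hx]
    exact (hS.principalIdeal_eq_of_mem hy).trans (hS.principalIdeal_mul_inv x)
  · have hbrandt : ∀ i, NeZero (n i) ∧
        relLength (J i : Set S) = relLength (BrandtSemigroup.nonzero (G i) (n i)) := by
      intro i
      obtain ⟨e, heG, he, hGe⟩ := hS.exists_eq_maximalSubgroup (hG i).1
      obtain ⟨x, hx⟩ := hJ i
      have hex : principalIdeal e = principalIdeal x := by
        have := (hG i).2 heG
        rwa [hx] at this
      have hni := hn i
      rw [hx, hS.numLClasses_eq, ← hex] at hni
      -- The identity `e` of the subgroup is one of the idempotents counted by `n i`. Positivity is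
      -- what makes `n i - 1` cast correctly at the end.
      refine ⟨⟨hni.trans_ne (Set.ncard_ne_zero_of_mem (a := e) ⟨he, rfl⟩)⟩, ?_⟩
      rw [hx, ← hex, hGe]
      exact hS.relLength_jClass he hni
    have hlen : semigroupLength S =
        -1 + ∑ i, (relLength (BrandtSemigroup.nonzero (G i) (n i)) : ℤ) := by
      rw [semigroupLength_eq_relLength_univ, relLength_univ_eq_sum_jClasses J,
        Finset.sum_congr rfl fun i _ => (hbrandt i).2]
      push_cast
      ring
    refine ⟨?_, ?_⟩
    · rw [hlen]
      exact congrArg _ (Finset.sum_congr rfl fun i _ => BrandtSemigroup.semigroupLength_eq.symm)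
    · rw [hlen]
      push_cast
      refine congrArg _ (Finset.sum_congr rfl fun i _ => ?_)
      have := (hbrandt i).1
      obtain ⟨e, he, h1, h2⟩ := (hG i).1.1
      rw [BrandtSemigroup.relLength_nonzero_of_isGroup ⟨⟨e, he⟩,
          fun a => ⟨Subtype.ext (h1 a a.2).1, Subtype.ext (h1 a a.2).2⟩, fun a => by
            obtain ⟨b, hb, h3, h4⟩ := h2 a a.2
            exact ⟨⟨b, hb⟩, Subtype.ext h3, Subtype.ext h4⟩⟩,
        semigroupLength_eq_relLength_univ]
      push_cast [Nat.cast_choose_two, Nat.cast_sub (NeZero.one_le (n := n i))]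
      ring
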